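/- Let $n\ge k\ge 1$ be integers and let $\beta=(\beta_1,\beta_2,\dots)$ be a weak composition of $n$, i.e. a sequence of nonnegative integers with $\sum_i\beta_i=n$. Let $\mathcal{OP}_{\beta,k}$ be the (finite) set of sequences $\mu=B_1|\cdots|B_k$ of nonempty sets of positive integers whose multiset union is $\{1^{\beta_1},2^{\beta_2},\dots\}$. Encode $\mu\in\mathcal{OP}_{\beta,k}$ by the word $\iota(\mu)=u_1u_2\cdots$ of length $n$, where $u_i=j_1\cdots j_{\beta_i}$ lists, in increasing order, the indices $j\in\{1,\dots,k\}$ with $i\in B_j$. For a word $w=w_1\cdots w_n$ of positive integers, let $\mathrm{Asc}(w)=\{i: 1\le i<n,\ w_i<w_{i+1}\}$, let $\mathrm{bk}(w)$ be its largest letter and $\mathrm{pro}(w)$ the position of its rightmost letter $1$. For integers $a,b$, write $a\succ b$ if both $a$ and $b$ occur in $w$ and the leftmost occurrence of $a$ is to the right of the rightmost occurrence of $b$; let $\chi$ of a statement be $1$ if it is true and $0$ otherwise. Put $$\mathrm{bmajMIL}(w)=\sum_{i\ge1} i\,\chi(i\succ i+1)+\sum_{i=1}^n(w_i-1),\qquad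 \mathrm{bndes}(w)=\mathrm{bk}(w)-1-\sum_{i\ge1}\chi(i\succ i+1),$$ $$\mathrm{bmajBAST}(w)=\mathrm{bmajMIL}(w)+\mathrm{pro}(w)+\mathrm{bndes}(w)-n,$$ and, for $\mu\in\mathcal{OP}_{\beta,k}$, put $\mathrm{Asc}(\mu)=\mathrm{Asc}(\iota(\mu))$, $\mathrm{bmajMIL}(\mu)=\mathrm{bmajMIL}(\iota(\mu))$, $\mathrm{bmajBAST}(\mu)=\mathrm{bmajBAST}(\iota(\mu))$. Then $(\mathrm{Asc},\mathrm{bmajMIL})$ and $(\mathrm{Asc},\mathrm{bmajBAST})$ have the same joint distribution on $\mathcal{OP}_{\beta,k}$: for every set $S$ of positive integers and every integer $m$, $$\#\{\mu\in\mathcal{OP}_{\beta,k}:\mathrm{Asc}(\mu)=S,\ \mathrm{bmajMIL}(\mu)=m\}=\#\{\mu\in\mathcal{OP}_{\beta,k}:\mathrm{Asc}(\mu)=S,\ \mathrm{bmajBAST}(\mu)=m\}.$$ -/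

import Mathlib

namespace OMP

/-! ### Statistics on words

A word `w = w₁ ⋯ wₙ` on the positive integers is a list of natural numbers; positions are counted
from `1`. -/

/-- The set of positions `{1, …, n}` of a word of length `n`. -/
def positions (w : List ℕ) : Finset ℕ := Finset.Icc 1 w.length

/-- The letter `wᵢ` at position `i`, for `1 ≤ i ≤ n`. -/
def letter (w : List ℕ) (i : ℕ) : ℕ := w.getD (i - 1) 0

/-- `Asc(w)`, the set of positions `i` with `1 ≤ i < n` and `wᵢ < wᵢ₊₁`. -/
def Asc (w : List ℕ) : Finset ℕ :=
  (positions w).filter fun i => i + 1 ∈ positions w ∧ letter w i < letter w (i + 1)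

/-- `L(w)`, the positions `i` such that `wᵢ` is the leftmost occurrence of its value. -/
def L (w : List ℕ) : Finset ℕ :=
  (positions w).filter fun i => ∀ j ∈ positions w, letter w j = letter w i → i ≤ j

/-- `R(w)`, the positions `i` such that `wᵢ` is the rightmost occurrence of its value. -/
def R (w : List ℕ) : Finset ℕ :=
  (positions w).filter fun i => ∀ j ∈ positions w, letter w j = letter w i → j ≤ i

/-- The relation `a ≻ b` of the word `w`: there are `i ∈ L(w)` and `j ∈ R(w)` with `wᵢ = a`,
`wⱼ = b` and `i > j`. -/
def Succ (w : List ℕ) (a b : ℕ) : Prop :=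
  ∃ i ∈ L w, ∃ j ∈ R w, letter w i = a ∧ letter w j = b ∧ j < i

instance (w : List ℕ) (a b : ℕ) : Decidable (Succ w a b) := by
  unfold Succ; infer_instance

/-- `bk(w)`, the largest letter of `w`. -/
def bk (w : List ℕ) : ℕ := (positions w).sup (letter w)

/-- `pro(w)`, the position of the rightmost `1` in `w`. -/
def pro (w : List ℕ) : ℕ := ((positions w).filter fun i => letter w i = 1).sup id

/-- `MIL(w) = ∑ᵢ (wᵢ - 1)`. -/
def MIL (w : List ℕ) : ℤ := ∑ i ∈ positions w, ((letter w i : ℤ) - 1)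

/-- `bMAJ(w) = ∑ᵢ i χ(i ≻ i + 1)`. Only `1 ≤ i < bk(w)` can contribute. -/
def bMAJ (w : List ℕ) : ℤ :=
  ∑ i ∈ Finset.Icc 1 (bk w), if Succ w i (i + 1) then (i : ℤ) else 0

/-- `bmajMIL(w) = bMAJ(w) + MIL(w)`. -/
def bmajMIL (w : List ℕ) : ℤ := bMAJ w + MIL w

/-- Block nondescents: `bndes(w) = bk(w) - 1 - ∑ᵢ χ(i ≻ i + 1)`. -/
def bndes (w : List ℕ) : ℤ :=
  (bk w : ℤ) - 1 - ∑ i ∈ Finset.Icc 1 (bk w), if Succ w i (i + 1) then (1 : ℤ) else 0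

/-- `bmajBAST(w) = bmajMIL(w) + pro(w) + bndes(w) - n`, where `n` is the length of `w`. -/
def bmajBAST (w : List ℕ) : ℤ := bmajMIL w + pro w + bndes w - w.length

/-! ### Ordered multiset partitions -/

/-- `β ⊨₀ n`: the finitely supported sequence `β = (β₁, β₂, …)` is a weak composition of `n`. -/
def IsWeakComposition (β : ℕ+ →₀ ℕ) (n : ℕ) : Prop := (β.sum fun _ b => b) = n

/-- `OP_{β,k}`: sequences `B₁ | ⋯ | B_k` of nonempty finite sets of positive integers whose
multiset union is `{1^β₁, 2^β₂, …}`. The block `B_j` is `μ (j - 1)`. -/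
def OP (β : ℕ+ →₀ ℕ) (k : ℕ) : Set (Fin k → Finset ℕ+) :=
  {μ | (∀ j, (μ j).Nonempty) ∧ ∑ j, (μ j).val = Finsupp.toMultiset β}

/-- The increasing list `j₁ < j₂ < ⋯` of the indices (in `{1, …, k}`) of the blocks
containing the letter `i`. -/
def blockIndices {k : ℕ} (μ : Fin k → Finset ℕ+) (i : ℕ+) : List ℕ :=
  ((List.finRange k).filter fun j => i ∈ μ j).map fun j => (j : ℕ) + 1

/-- The word `ι(μ) = u₁ u₂ ⋯`, where `uᵢ` is the increasing list of the indices of the blocks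
containing `i`; `i` runs in increasing order over the letters that occur in `μ`. -/
def iota {k : ℕ} (μ : Fin k → Finset ℕ+) : List ℕ :=
  ((Finset.univ.biUnion μ).sort (· ≤ ·)).flatMap (blockIndices μ)

/-- The two statistics `f` and `g` have the same distribution on `X`: they take each value equally
often. -/
def SameDistribution {α γ : Type*} (X : Set α) (f g : α → γ) : Prop :=
  ∀ v : γ, {x ∈ X | f x = v}.encard = {x ∈ X | g x = v}.encard

/-- There are only finitely many ordered multiset partitions of given weight and block number. -/
theorem OP_finite (β : ℕ+ →₀ ℕ) (k : ℕ) : (OP β k).Finite := by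
  refine Set.Finite.subset
    (Set.Finite.pi' (fun _ : Fin k => (β.support.powerset : Finset (Finset ℕ+)).finite_toSet)) ?_
  intro μ hμ j
  simp only [Finset.mem_coe, Finset.mem_powerset]
  intro i hi
  have h : i ∈ Finsupp.toMultiset β := by
    rw [← hμ.2]
    exact Multiset.mem_sum.2 ⟨j, Finset.mem_univ j, hi⟩
  exact (Finsupp.mem_toMultiset β i).1 h

end OMP

/-! The word `iota μ` lists block indices along the pairs (v, j), v ∈ B_j, in lexicographic order.
Let `cs` be the weakly increasing list of the letters of μ. Then `iota` is a bijection from `OP β k`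
onto the words with letter set {1, …, k} that ascend wherever `cs` has two equal neighbours
(`bijOn_iota`). Hence the words with ascent set exactly S do not depend on β, apart from the
condition that S contains the ties. Every D ⊆ {1, …, n-1} is the tie set of some weight
(`exists_tieSet_eq`), so the counts with D ⊆ Asc(w) are counts over whole sets `OP β k`, and
inclusion–exclusion (`card_filter_eq_of_superset`) recovers the counts with Asc(w) = S. It remains
to see that the two statistics, without `Asc`, are equidistributed on each `OP β k`.

For this, read both statistics off the blocks and sum q^stat x^μ over all sequences of k nonempty
subsets of a finite set A. With c(k, j) = (-1)^(k-j) q^(k-j choose 2) [k choose j]_q, both sums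
equal ∑_j c(k, j) ∏_{a<j} ∏_{i∈A} (1 + q^a x_i). For `bmajMIL` (`sum_blockMajMIL`) the last block is
removed repeatedly, remembering only its minimum. For `bmajBAST` (`sum_blockMajBAST`) the first
block B is removed once; what remains is a `bmajMIL` sum in which x_v is replaced by q x_v for v <
max B. Comparing coefficients gives the equidistribution. -/

namespace OMP

/-! ### Signed q-binomial coefficients. -/

section GeneratingFunctions

variable {K : Type*} [Field K] {α : Type*}

/-- The signed `q`-binomial coefficients `(-1)^(k-j) q^(k-j choose 2) [k choose j]_q`, given by
their Pascal recursion. -/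
def signedQBinom (q : K) : ℕ → ℕ → K
  | 0, 0 => 1
  | 0, _ + 1 => 0
  | k + 1, 0 => -q ^ k * signedQBinom q k 0
  | k + 1, j + 1 => q ^ k * (signedQBinom q k j / q ^ j - signedQBinom q k (j + 1) / q ^ (j + 1))

lemma signedQBinom_eq_zero_of_lt (q : K) : ∀ {k j : ℕ}, k < j → signedQBinom q k j = 0
  | 0, j + 1, _ => by simp [signedQBinom]
  | k + 1, j + 1, h => by
    rw [signedQBinom, signedQBinom_eq_zero_of_lt q (by omega : k < j),
      signedQBinom_eq_zero_of_lt q (by omega : k < j + 1)]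
    simp

lemma signedQBinom_self {q : K} (hq : q ≠ 0) : ∀ k : ℕ, signedQBinom q k k = 1
  | 0 => by simp [signedQBinom]
  | k + 1 => by
    rw [signedQBinom, signedQBinom_self hq k, signedQBinom_eq_zero_of_lt q (by omega : k < k + 1)]
    field_simp
    simp

/-- Absorption identities, proved together because the Pascal recursion mixes the indices j and j +
1, so each inductive step needs both. The factor q^(k+1) - q^j is the denominator that arises in
`sum_signedQBinom_transfer`. -/
lemma signedQBinom_succ_mul {q : K} (hq : q ≠ 0) (k : ℕ) :
    (∀ j, signedQBinom q (k + 1) j * (q ^ (k + 1) - q ^ j) =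
      -q ^ k * signedQBinom q k j * (q ^ (k + 1) - 1)) ∧
    ∀ j, signedQBinom q (k + 1) (j + 1) * (q ^ (j + 1) - 1) =
      signedQBinom q k j * (q ^ (k + 1) - 1) := by
  induction k with
  | zero =>
    constructor
    · rintro (_ | _ | j) <;> simp [signedQBinom]
    · rintro (_ | j) <;> simp [signedQBinom]
  | succ k ih =>
    obtain ⟨h1, h2⟩ := ih
    constructor
    · rintro (_ | j)
      · rw [signedQBinom]; simp
      · have e1 := h1 j
        have e2 := h2 j
        rw [signedQBinom.eq_4 q (k + 1) j]
        field_simp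
        have e3 : signedQBinom q (k + 1) j * (q ^ (k + 1) - q ^ j) =
          -q ^ k * (signedQBinom q (k + 1) (j + 1) * (q ^ (j + 1) - 1)) := by
          rw [e1, e2]; ring
        linear_combination q ^ (j + 2) * e3
    · intro j
      have e1 := h1 j
      have e2 := h2 j
      rw [signedQBinom.eq_4 q (k + 1) j]
      field_simp
      have e3 : signedQBinom q (k + 1) j * (q ^ (k + 1) - q ^ j) =
          -q ^ k * (signedQBinom q (k + 1) (j + 1) * (q ^ (j + 1) - 1)) := by
          rw [e1, e2]; ring
      linear_combination -q ^ (j + 1) * e3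

/-- Summation by parts: moving the difference from P to the coefficients produces exactly the Pascal
recursion. -/
lemma sum_signedQBinom_div {q : K} (k : ℕ) (P : ℕ → K) :
    q ^ k * ∑ j ∈ Finset.range (k + 1), signedQBinom q k j / q ^ j * (P (j + 1) - P j) =
      ∑ j ∈ Finset.range (k + 2), signedQBinom q (k + 1) j * P j := by
  have h : ∑ j ∈ Finset.range (k + 1), signedQBinom q k j / q ^ j * P j =
      ∑ j ∈ Finset.range (k + 1), signedQBinom q k (j + 1) / q ^ (j + 1) * P (j + 1) +
        signedQBinom q k 0 * P 0 := by
    have := Finset.sum_range_succ' (fun j => signedQBinom q k j / q ^ j * P j) (k + 1)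
    rw [Finset.sum_range_succ, signedQBinom_eq_zero_of_lt q (by omega : k < k + 1)] at this
    simpa using this
  rw [Finset.sum_range_succ' _ (k + 1)]
  simp only [mul_sub, Finset.sum_sub_distrib, h, signedQBinom, sub_mul, mul_assoc,
    ← Finset.mul_sum]
  ring

/-- `∏_{i ∈ A} (1 + t xᵢ)`. -/
def esymGF (x : α → K) (A : Finset α) (t : K) : K := ∏ i ∈ A, (1 + t * x i)

/-- `∏_{a < j} ∏_{i ∈ A} (1 + q^a xᵢ)`. -/
def esymProd (q : K) (x : α → K) (A : Finset α) (j : ℕ) : K :=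
  ∏ a ∈ Finset.range j, esymGF x A (q ^ a)

lemma esymProd_succ (q : K) (x : α → K) (A : Finset α) (j : ℕ) :
    esymProd q x A (j + 1) = esymProd q x A j * esymGF x A (q ^ j) :=
  Finset.prod_range_succ _ _

/-! ### Telescoping products and sums over nonempty subsets. -/

variable [LinearOrder α]

/-- Telescoping: the factors are switched from r to s one element at a time, and the switch at m
contributes (s - r) x_m. -/
lemma sum_mul_esymGF_lt_gt (x : α → K) (A : Finset α) (s r : K) :
    (s - r) * ∑ m ∈ A, x m * esymGF x {i ∈ A | i < m} s * esymGF x {i ∈ A | m < i} r =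
      esymGF x A s - esymGF x A r := by
  have h := Finset.prod_add_ordered A (fun i => 1 + r * x i) (fun i => (s - r) * x i)
  have e : ∀ i, 1 + r * x i + (s - r) * x i = 1 + s * x i := fun i => by ring
  simp only [e] at h
  unfold esymGF
  rw [h, add_sub_cancel_left, Finset.mul_sum]
  exact Finset.sum_congr rfl fun m _ => by ring

lemma sum_mul_esymGF_gt (x : α → K) (A : Finset α) (r : K) :
    r * ∑ m ∈ A, x m * esymGF x {i ∈ A | m < i} r = esymGF x A r - 1 := by
  have h := sum_mul_esymGF_lt_gt x A 0 r
  simp only [esymGF, zero_mul, add_zero, Finset.prod_const_one, mul_one, zero_sub] at h ⊢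
  linear_combination -h

lemma sum_mul_esymGF_lt (x : α → K) (A : Finset α) (s : K) :
    s * ∑ m ∈ A, x m * esymGF x {i ∈ A | i < m} s = esymGF x A s - 1 := by
  have h := sum_mul_esymGF_lt_gt x A s 0
  simp only [esymGF, zero_mul, add_zero, Finset.prod_const_one, mul_one, sub_zero] at h ⊢
  linear_combination h

/-- The nonempty subsets of `A`. -/
def nonemptySubsets (A : Finset α) : Finset (Finset α) := A.powerset.erase ∅

lemma mem_nonemptySubsets {A B : Finset α} : B ∈ nonemptySubsets A ↔ B.Nonempty ∧ B ⊆ A := by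
  simp [nonemptySubsets, Finset.nonempty_iff_ne_empty]

lemma sum_nonemptySubsets_insert {M : Type*} [AddCommMonoid M] {a : α} {A : Finset α} (ha : a ∉ A)
    (f : Finset α → M) :
    ∑ B ∈ nonemptySubsets (insert a A), f B =
      ∑ B ∈ nonemptySubsets A, f B + ∑ B ∈ A.powerset, f (insert a B) := by
  have h : nonemptySubsets (insert a A) = nonemptySubsets A ∪ A.powerset.image (insert a) := by
    unfold nonemptySubsets
    rw [Finset.powerset_insert, Finset.erase_union_distrib]
    congr 1
    rw [Finset.erase_eq_of_notMem]
    simp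
  rw [h, Finset.sum_union, Finset.sum_image]
  · intro B hB C hC hBC
    have hB' : a ∉ B := fun h => ha (Finset.mem_powerset.1 hB h)
    have hC' : a ∉ C := fun h => ha (Finset.mem_powerset.1 hC h)
    rw [← Finset.erase_insert hB', hBC, Finset.erase_insert hC']
  · rw [Finset.disjoint_left]
    intro B hB hB'
    obtain ⟨C, -, rfl⟩ := Finset.mem_image.1 hB'
    exact ha ((mem_nonemptySubsets.1 hB).2 (Finset.mem_insert_self a C))

/-- Subsets are grouped by their least element m; the other elements form an arbitrary subset of
those above m, which gives the product of 1 + y_i. The induction adds a new least element to A. -/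
lemma sum_nonemptySubsets_min (y : α → K) (h : α → K) (g : Finset α → K) (A : Finset α)
    (hg : ∀ B ⊆ A, ∀ m ∈ B, (∀ u ∈ B, m ≤ u) → g B = h m) :
    ∑ B ∈ nonemptySubsets A, g B * ∏ i ∈ B, y i =
      ∑ m ∈ A, h m * (y m * ∏ i ∈ A with m < i, (1 + y i)) := by
  induction A using Finset.induction_on_min with
  | empty => simp [nonemptySubsets]
  | insert a A ha ih =>
    have haA : a ∉ A := fun h => lt_irrefl _ (ha a h)
    rw [sum_nonemptySubsets_insert haA, ih fun B hB => hg B (hB.trans (Finset.subset_insert _ _)),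
      Finset.sum_insert haA, add_comm]
    congr 1
    · have e : {i ∈ insert a A | a < i} = A := by
        ext i; simp only [Finset.mem_filter, Finset.mem_insert]
        constructor
        · rintro ⟨rfl | h, h'⟩
          · exact absurd h' (lt_irrefl _)
          · exact h
        · exact fun h => ⟨Or.inr h, ha i h⟩
      rw [e, Finset.prod_one_add, ← mul_assoc, Finset.mul_sum]
      refine Finset.sum_congr rfl fun B hB => ?_
      have hB' := Finset.mem_powerset.1 hB
      rw [Finset.prod_insert fun h => haA (hB' h), ← mul_assoc]
      congr 2
      refine hg _ (Finset.insert_subset_insert _ hB') a (Finset.mem_insert_self _ _) fun u hu => ?_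
      rcases Finset.mem_insert.1 hu with rfl | hu
      · exact le_rfl
      · exact (ha u (hB' hu)).le
    · refine Finset.sum_congr rfl fun m hm => ?_
      rw [Finset.filter_insert, if_neg (ha m hm).not_gt]

lemma sum_nonemptySubsets_max (y : α → K) (h : α → K) (g : Finset α → K) (A : Finset α)
    (hg : ∀ B ⊆ A, ∀ m ∈ B, (∀ u ∈ B, u ≤ m) → g B = h m) :
    ∑ B ∈ nonemptySubsets A, g B * ∏ i ∈ B, y i =
      ∑ m ∈ A, h m * (y m * ∏ i ∈ A with i < m, (1 + y i)) :=
  sum_nonemptySubsets_min (α := αᵒᵈ) y h g A hg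

lemma sum_piFinset_snoc {M β : Type*} [AddCommMonoid M] [DecidableEq β] (k : ℕ) (S : Finset β)
    (f : (Fin (k + 1) → β) → M) :
    ∑ μ ∈ Fintype.piFinset (fun _ : Fin (k + 1) => S), f μ =
      ∑ μ ∈ Fintype.piFinset (fun _ : Fin k => S), ∑ B ∈ S, f (Fin.snoc μ B) := by
  rw [← Finset.sum_product']
  refine Finset.sum_nbij' (fun μ => (Fin.init μ, μ (Fin.last k)))
    (fun p => Fin.snoc p.1 p.2) ?_ ?_ ?_ ?_ ?_
  · intro μ hμ
    simp only [Fintype.mem_piFinset, Finset.mem_product] at hμ ⊢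
    exact ⟨fun i => hμ _, hμ _⟩
  · rintro ⟨μ, B⟩ h
    simp only [Fintype.mem_piFinset, Finset.mem_product] at h ⊢
    intro i
    refine Fin.lastCases ?_ (fun i => ?_) i <;> simp [h.1, h.2]
  · intro μ _; simp
  · rintro ⟨μ, B⟩ _; simp
  · intro μ _; simp

lemma sum_piFinset_cons {M β : Type*} [AddCommMonoid M] [DecidableEq β] (k : ℕ) (S : Finset β)
    (f : (Fin (k + 1) → β) → M) :
    ∑ μ ∈ Fintype.piFinset (fun _ : Fin (k + 1) => S), f μ =
      ∑ B ∈ S, ∑ μ ∈ Fintype.piFinset (fun _ : Fin k => S), f (Fin.cons B μ) := by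
  rw [← Finset.sum_product']
  refine Finset.sum_nbij' (fun μ => (μ 0, Fin.tail μ))
    (fun p => Fin.cons p.1 p.2) ?_ ?_ ?_ ?_ ?_
  · intro μ hμ
    simp only [Fintype.mem_piFinset, Finset.mem_product] at hμ ⊢
    exact ⟨hμ _, fun i => hμ _⟩
  · rintro ⟨B, μ⟩ h
    simp only [Fintype.mem_piFinset, Finset.mem_product] at h ⊢
    intro i
    refine Fin.cases ?_ (fun i => ?_) i <;> simp [h.1, h.2]
  · intro μ _; simp
  · rintro ⟨B, μ⟩ _; simp
  · intro μ _; simp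

/-! ### Block statistics and their generating functions. -/

/-- There is a block descent from `B` to `C`: every element of `B` exceeds every element of `C`. -/
def BlockDescent (B C : Finset α) : Prop := ∀ u ∈ B, ∀ v ∈ C, v < u

instance (B C : Finset α) : Decidable (BlockDescent B C) := by
  unfold BlockDescent; infer_instance

/-- The statistic `bmajMIL` in terms of the blocks. -/
def blockMajMIL {k : ℕ} (μ : Fin (k + 1) → Finset α) : ℕ :=
  ∑ j : Fin (k + 1), (j : ℕ) * (μ j).card +
    ∑ i : Fin k, if BlockDescent (μ i.castSucc) (μ i.succ) then (i : ℕ) + 1 else 0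

/-- The statistic `bmajBAST` in terms of the blocks. -/
def blockMajBAST {k : ℕ} (μ : Fin (k + 1) → Finset α) : ℕ :=
  k + (∑ i : Fin k, if BlockDescent (μ i.castSucc) (μ i.succ) then (i : ℕ) else 0) +
    ∑ j : Fin k, ∑ v ∈ μ j.succ, if ∃ u ∈ μ 0, v < u then (j : ℕ) + 1 else j

lemma blockMajMIL_snoc {k : ℕ} (μ : Fin (k + 1) → Finset α) (B : Finset α) :
    blockMajMIL (Fin.snoc μ B : Fin (k + 2) → Finset α) =
      blockMajMIL μ + (k + 1) * B.card +
        if BlockDescent (μ (Fin.last k)) B then k + 1 else 0 := by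
  unfold blockMajMIL
  rw [Fin.sum_univ_castSucc,
    Fin.sum_univ_castSucc (fun i : Fin (k + 1) => if BlockDescent _ _ then (i : ℕ) + 1 else 0)]
  simp only [Fin.snoc_castSucc, Fin.snoc_last, Fin.val_last, Fin.val_castSucc, Fin.succ_last,
    Fin.succ_castSucc]
  ring

/-- A descent between the first two blocks has weight 0 in `blockMajBAST`, and the later descents
have the weights that `blockMajMIL` gives them once B is deleted. So B interacts with the rest only
through the number of entries below max B. -/
lemma blockMajBAST_cons {k : ℕ} (B : Finset α) (ν : Fin (k + 1) → Finset α) :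
    blockMajBAST (Fin.cons B ν : Fin (k + 2) → Finset α) =
      (k + 1) + blockMajMIL ν + ∑ j, ∑ v ∈ ν j, if ∃ u ∈ B, v < u then 1 else 0 := by
  have h : ∀ j : Fin (k + 1), (∑ v ∈ ν j, if ∃ u ∈ B, v < u then (j : ℕ) + 1 else j) =
      j * (ν j).card + ∑ v ∈ ν j, if ∃ u ∈ B, v < u then 1 else 0 := by
    intro j
    rw [mul_comm, ← smul_eq_mul, ← Finset.sum_const, ← Finset.sum_add_distrib]
    exact Finset.sum_congr rfl fun v _ => by split_ifs <;> simp
  unfold blockMajBAST blockMajMIL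
  rw [Fin.sum_univ_succ]
  simp only [Fin.cons_succ, Fin.cons_zero, h, Finset.sum_add_distrib, Fin.castSucc_succ,
    Fin.val_zero, ite_self, Fin.val_succ]
  ring

/-- The monomial `∏_j ∏_{v ∈ B_j} x_v` of a sequence of blocks. -/
def blockMonomial {k : ℕ} (x : α → K) (μ : Fin k → Finset α) : K := ∏ j, ∏ v ∈ μ j, x v

/-- Sums out a block B that follows C. A descent means that B lies below m' = min C; writing its
weight s as 1 + (s - 1) splits the sum into one over all B and one over B below m'. The result
depends on C only through m', so the procedure can be iterated. -/
lemma sum_nonemptySubsets_descent {s : K} (x : α → K) (A : Finset α) (h : α → K)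
    (g : Finset α → K) (hg : ∀ B ⊆ A, ∀ m ∈ B, (∀ u ∈ B, m ≤ u) → g B = h m)
    (C : Finset α) (m' : α) (hm' : m' ∈ C) (hC : ∀ u ∈ C, m' ≤ u) :
    ∑ B ∈ nonemptySubsets A,
        (if BlockDescent C B then s else 1) * g B * (s ^ B.card * ∏ v ∈ B, x v) =
      ∑ m ∈ A, h m * (s * x m) * (esymGF x {i ∈ A | m < i} s +
        if m < m' then (s - 1) * esymGF x {i ∈ {i ∈ A | i < m'} | m < i} s else 0) := by
  have hdes : ∀ B, BlockDescent C B ↔ ∀ v ∈ B, v < m' := fun B =>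
    ⟨fun H v hv => H m' hm' v hv, fun H u hu v hv => (H v hv).trans_le (hC u hu)⟩
  have hfil : {B ∈ nonemptySubsets A | BlockDescent C B} = nonemptySubsets {i ∈ A | i < m'} := by
    ext B
    simp only [Finset.mem_filter, mem_nonemptySubsets, hdes, Finset.subset_iff]
    exact ⟨fun H => ⟨H.1.1, fun v hv => ⟨H.1.2 hv, H.2 v hv⟩⟩,
      fun H => ⟨⟨H.1, fun v hv => (H.2 hv).1⟩, fun v hv => (H.2 hv).2⟩⟩
  have hprod : ∀ B : Finset α, s ^ B.card * ∏ v ∈ B, x v = ∏ v ∈ B, (s * x v) := fun B => by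
    rw [Finset.prod_mul_distrib, Finset.prod_const]
  have e1 := sum_nonemptySubsets_min (fun v => s * x v) h g A hg
  have e2 := sum_nonemptySubsets_min (fun v => s * x v) h g {i ∈ A | i < m'}
    fun B hB => hg B (hB.trans (Finset.filter_subset _ _))
  have e3 : ∀ B : Finset α,
      (if BlockDescent C B then s else 1) * g B * (s ^ B.card * ∏ v ∈ B, x v) =
        g B * ∏ v ∈ B, (s * x v) +
          (s - 1) * if BlockDescent C B then g B * ∏ v ∈ B, (s * x v) else 0 := fun B => by
    rw [hprod]; split_ifs <;> ring
  simp only [e3, Finset.sum_add_distrib, ← Finset.mul_sum]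
  rw [← Finset.sum_filter, hfil, e1, e2, Finset.sum_filter, Finset.mul_sum,
    ← Finset.sum_add_distrib]
  refine Finset.sum_congr rfl fun m _ => ?_
  unfold esymGF
  split_ifs <;> ring

/-- One step of the transfer: summing over the minimum m' of the previous block reproduces the same
expression with k + 1 in place of k. Both sums over m' telescope, and the division by q^(k+1) - q^j
is where q must not be a root of unity. -/
lemma sum_signedQBinom_transfer {q : K} (hq : q ≠ 0) (hq1 : ∀ n : ℕ, 0 < n → q ^ n ≠ 1) (k : ℕ)
    (x : α → K) (A : Finset α) (m : α) :
    ∑ m' ∈ A, (esymGF x {i ∈ A | m < i} (q ^ (k + 1)) +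
        if m < m' then (q ^ (k + 1) - 1) *
          esymGF x {i ∈ {i ∈ A | i < m'} | m < i} (q ^ (k + 1)) else 0) *
      (x m' * ∑ j ∈ Finset.range (k + 1),
        signedQBinom q k j * esymProd q x A j * esymGF x {i ∈ A | m' < i} (q ^ j)) * q ^ k =
      ∑ j ∈ Finset.range (k + 2),
        signedQBinom q (k + 1) j * esymProd q x A j * esymGF x {i ∈ A | m < i} (q ^ j) := by
  set s := q ^ (k + 1) with hs
  set P := esymProd q x A with hP
  have hne : ∀ j < k + 1, s - q ^ j ≠ 0 := by
    intro j hj h0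
    refine hq1 (k + 1 - j) (by omega) ?_
    have h1 : q ^ (k + 1 - j) * q ^ j = 1 * q ^ j := by
      rw [← pow_add, one_mul, Nat.sub_add_cancel hj.le]; exact sub_eq_zero.1 h0
    exact mul_right_cancel₀ (pow_ne_zero _ hq) h1
  have hA : ∀ j, ∑ m' ∈ A, x m' * esymGF x {i ∈ A | m' < i} (q ^ j) =
      (esymGF x A (q ^ j) - 1) / q ^ j := fun j => by
    rw [eq_div_iff (pow_ne_zero _ hq), mul_comm]
    exact sum_mul_esymGF_gt x A (q ^ j)
  have hB : ∀ j < k + 1, ∑ m' ∈ A, (if m < m' then x m' *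
      esymGF x {i ∈ {i ∈ A | i < m'} | m < i} s * esymGF x {i ∈ A | m' < i} (q ^ j) else 0) =
      (esymGF x {i ∈ A | m < i} s - esymGF x {i ∈ A | m < i} (q ^ j)) / (s - q ^ j) := by
    intro j hj
    rw [eq_div_iff (hne j hj), mul_comm, ← sum_mul_esymGF_lt_gt, Finset.sum_filter]
    congr 1
    refine Finset.sum_congr rfl fun m' _ => ?_
    split_ifs with hm
    · rw [Finset.filter_comm]
      congr 2
      rw [Finset.filter_filter]
      exact Finset.filter_congr fun i _ => ⟨fun h => ⟨hm.trans h, h⟩, fun h => h.2⟩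
    · rfl
  have hC : ∀ j < k + 1, signedQBinom q (k + 1) j =
      -q ^ k * signedQBinom q k j * (s - 1) / (s - q ^ j) := fun j hj => by
    rw [eq_div_iff (hne j hj)]
    exact (signedQBinom_succ_mul hq k).1 j
  have hD : q ^ k * ∑ j ∈ Finset.range (k + 1), signedQBinom q k j / q ^ j * (P (j + 1) - P j) =
      ∑ j ∈ Finset.range (k + 2), signedQBinom q (k + 1) j * P j := sum_signedQBinom_div k P
  rw [Finset.sum_range_succ _ (k + 1), signedQBinom_self hq] at hD
  have hE : ∀ j, P (j + 1) - P j = P j * (esymGF x A (q ^ j) - 1) := fun j => by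
    rw [hP, esymProd_succ]; ring
  calc _ = ∑ j ∈ Finset.range (k + 1), q ^ k * (signedQBinom q k j * P j * (
        esymGF x {i ∈ A | m < i} s * ∑ m' ∈ A, x m' * esymGF x {i ∈ A | m' < i} (q ^ j) +
        (s - 1) * ∑ m' ∈ A, (if m < m' then x m' *
          esymGF x {i ∈ {i ∈ A | i < m'} | m < i} s * esymGF x {i ∈ A | m' < i} (q ^ j)
          else 0))) := by
        simp only [Finset.mul_sum, Finset.sum_mul, ← Finset.sum_add_distrib]
        rw [Finset.sum_comm]
        refine Finset.sum_congr rfl fun j _ => Finset.sum_congr rfl fun m' _ => ?_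
        split_ifs <;> ring
    _ = ∑ j ∈ Finset.range (k + 1), (
        esymGF x {i ∈ A | m < i} s * (q ^ k * (signedQBinom q k j / q ^ j * (P (j + 1) - P j)))
        - esymGF x {i ∈ A | m < i} s * (signedQBinom q (k + 1) j * P j)
        + signedQBinom q (k + 1) j * P j * esymGF x {i ∈ A | m < i} (q ^ j)) := by
        refine Finset.sum_congr rfl fun j hj => ?_
        have hj' := Finset.mem_range.1 hj
        rw [hA, hB j hj', hE, hC j hj']
        ring
    -- By `hD` the terms carrying the factor at s cancel except for s-factor times P (k + 1). Since
    -- s = q^(k+1), this is the missing summand j = k + 1.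
    _ = _ := by
        rw [Finset.sum_range_succ _ (k + 1), signedQBinom_self hq, Finset.sum_add_distrib,
          Finset.sum_sub_distrib, ← Finset.mul_sum, ← Finset.mul_sum, ← Finset.mul_sum, hD, ← hs]
        ring

/-- The weight g on the last block is what makes the induction close: summing out that block leaves
a new weight on its predecessor, again a function of the minimum alone. -/
theorem sum_blockMajMIL_last {q : K} (hq : q ≠ 0) (hq1 : ∀ n : ℕ, 0 < n → q ^ n ≠ 1)
    (x : α → K) (A : Finset α) (k : ℕ) (h : α → K) (g : Finset α → K)
    (hg : ∀ B ⊆ A, ∀ m ∈ B, (∀ u ∈ B, m ≤ u) → g B = h m) :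
    ∑ μ ∈ Fintype.piFinset (fun _ : Fin (k + 1) => nonemptySubsets A),
        q ^ blockMajMIL μ * blockMonomial x μ * g (μ (Fin.last k)) =
      q ^ k * ∑ m ∈ A, h m * (x m * ∑ j ∈ Finset.range (k + 1),
        signedQBinom q k j * esymProd q x A j * esymGF x {i ∈ A | m < i} (q ^ j)) := by
  induction k generalizing h g with
  | zero =>
    rw [sum_piFinset_snoc]
    have e := sum_nonemptySubsets_min x h g A hg
    simpa [blockMajMIL, blockMonomial, signedQBinom, esymProd, esymGF, Fin.snoc, mul_comm (g _)]
      using e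
  | succ k ih =>
    set s := q ^ (k + 1) with hs
    set g' : Finset α → K := fun C => ∑ B ∈ nonemptySubsets A,
        (if BlockDescent C B then s else 1) * g B * (s ^ B.card * ∏ v ∈ B, x v) with hg'
    set h' : α → K := fun m' => ∑ m ∈ A, h m * (s * x m) * (esymGF x {i ∈ A | m < i} s +
        if m < m' then (s - 1) * esymGF x {i ∈ {i ∈ A | i < m'} | m < i} s else 0) with hh'
    have hrec := ih h' g' fun C _ m' hm' hC =>
      sum_nonemptySubsets_descent x A h g hg C m' hm' hC
    rw [sum_piFinset_snoc]
    calc _ = ∑ μ ∈ Fintype.piFinset (fun _ : Fin (k + 1) => nonemptySubsets A),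
          q ^ blockMajMIL μ * blockMonomial x μ * g' (μ (Fin.last k)) := by
          refine Finset.sum_congr rfl fun μ _ => ?_
          rw [hg', Finset.mul_sum]
          refine Finset.sum_congr rfl fun B _ => ?_
          rw [blockMajMIL_snoc, blockMonomial, Fin.prod_univ_castSucc]
          simp only [Fin.snoc_castSucc, Fin.snoc_last, pow_add, pow_mul, blockMonomial, ← hs]
          split_ifs
          · rw [← hs]; ring
          · ring
      _ = _ := by
          rw [hrec, Finset.mul_sum, hh']
          simp only [Finset.sum_mul, Finset.mul_sum (s := A)]
          rw [Finset.sum_comm]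
          refine Finset.sum_congr rfl fun m _ => ?_
          rw [← sum_signedQBinom_transfer hq hq1, Finset.mul_sum, Finset.mul_sum, Finset.mul_sum]
          refine Finset.sum_congr rfl fun m' _ => ?_
          ring

theorem sum_blockMajMIL {q : K} (hq : q ≠ 0) (hq1 : ∀ n : ℕ, 0 < n → q ^ n ≠ 1)
    (x : α → K) (A : Finset α) (k : ℕ) :
    ∑ μ ∈ Fintype.piFinset (fun _ : Fin (k + 1) => nonemptySubsets A),
        q ^ blockMajMIL μ * blockMonomial x μ =
      ∑ j ∈ Finset.range (k + 2), signedQBinom q (k + 1) j * esymProd q x A j := by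
  have h := sum_blockMajMIL_last hq hq1 x A k (fun _ => 1) (fun _ => 1) (fun _ _ _ _ _ => rfl)
  simp only [mul_one, one_mul] at h
  rw [h, ← sum_signedQBinom_div]
  simp only [Finset.mul_sum]
  rw [Finset.sum_comm]
  refine Finset.sum_congr rfl fun j _ => ?_
  rw [esymProd_succ, ← mul_sub_one, ← sum_mul_esymGF_gt, Finset.mul_sum, Finset.mul_sum,
    Finset.mul_sum, Finset.mul_sum]
  refine Finset.sum_congr rfl fun m _ => ?_
  field_simp

/-- Scaling x by q below m turns the a-th factor there into the (a + 1)-st, so the product over a <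
j telescopes: factor 0 is lost and factor j is gained. -/
lemma esymGF_mul_esymProd_scale (q : K) (x : α → K) (A : Finset α) (m : α) (j : ℕ) :
    esymGF x {i ∈ A | i < m} 1 * esymProd q (fun v => if v < m then q * x v else x v) A j =
      esymProd q x A j * esymGF x {i ∈ A | i < m} (q ^ j) := by
  have h : ∀ t, esymGF (fun v => if v < m then q * x v else x v) A t *
      esymGF x {i ∈ A | i < m} t = esymGF x A t * esymGF x {i ∈ A | i < m} (t * q) := by
    intro t
    unfold esymGF
    rw [Finset.prod_filter, Finset.prod_filter, ← Finset.prod_mul_distrib,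
      ← Finset.prod_mul_distrib]
    refine Finset.prod_congr rfl fun i _ => ?_
    dsimp only
    split_ifs <;> ring
  induction j with
  | zero => simp [esymProd]
  | succ j ih =>
    rw [esymProd_succ, esymProd_succ, ← mul_assoc, ih, pow_succ]
    linear_combination esymProd q x A j * h (q ^ j)

theorem sum_blockMajBAST {q : K} (hq : q ≠ 0) (hq1 : ∀ n : ℕ, 0 < n → q ^ n ≠ 1)
    (x : α → K) (A : Finset α) (k : ℕ) :
    ∑ μ ∈ Fintype.piFinset (fun _ : Fin (k + 1) => nonemptySubsets A),
        q ^ blockMajBAST μ * blockMonomial x μ =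
      ∑ j ∈ Finset.range (k + 2), signedQBinom q (k + 1) j * esymProd q x A j := by
  rcases k with _ | k
  -- With a single block both statistics vanish; the case is separate because `blockMajBAST_cons`
  -- needs a block after the first.
  · rw [← sum_blockMajMIL hq hq1]
    simp [blockMajMIL, blockMajBAST]
  set g : Finset α → K := fun B => ∑ ν ∈ Fintype.piFinset
    (fun _ : Fin (k + 1) => nonemptySubsets A), q ^ blockMajMIL ν *
      blockMonomial (fun v => if ∃ u ∈ B, v < u then q * x v else x v) ν with hgdef
  have hg : ∀ B ⊆ A, ∀ m ∈ B, (∀ u ∈ B, u ≤ m) → g B = ∑ j ∈ Finset.range (k + 2),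
      signedQBinom q (k + 1) j *
        esymProd q (fun v => if v < m then q * x v else x v) A j := by
    intro B _ m hm hB
    rw [← sum_blockMajMIL hq hq1]
    have : ∀ v, (∃ u ∈ B, v < u) ↔ v < m := fun v =>
      ⟨fun ⟨u, hu, h⟩ => h.trans_le (hB u hu), fun h => ⟨m, hm, h⟩⟩
    simp only [hgdef, this]
  have e := sum_nonemptySubsets_max x _ g A hg
  rw [sum_piFinset_cons, ← sum_signedQBinom_div]
  calc _ = q ^ (k + 1) * ∑ B ∈ nonemptySubsets A, g B * ∏ i ∈ B, x i := by
        rw [Finset.mul_sum]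
        refine Finset.sum_congr rfl fun B _ => ?_
        rw [hgdef, Finset.sum_mul, Finset.mul_sum]
        refine Finset.sum_congr rfl fun ν _ => ?_
        rw [blockMajBAST_cons, blockMonomial, Fin.prod_univ_succ, pow_add, pow_add,
          ← Finset.prod_pow_eq_pow_sum]
        simp only [← Finset.prod_pow_eq_pow_sum, Fin.cons_zero, Fin.cons_succ, blockMonomial]
        have : ∀ v, (if ∃ u ∈ B, v < u then q * x v else x v) =
            q ^ (if ∃ u ∈ B, v < u then 1 else 0) * x v := fun v => by split_ifs <;> simp
        simp only [this, Finset.prod_mul_distrib]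
        ring
    _ = _ := by
        rw [e]
        congr 1
        simp only [Finset.sum_mul]
        rw [Finset.sum_comm]
        refine Finset.sum_congr rfl fun j _ => ?_
        rw [esymProd_succ, ← mul_sub_one, ← sum_mul_esymGF_lt, Finset.mul_sum, Finset.mul_sum,
          Finset.mul_sum]
        refine Finset.sum_congr rfl fun m _ => ?_
        have h1 := esymGF_mul_esymProd_scale q x A m j
        have h2 : ∏ i ∈ A with i < m, (1 + x i) = esymGF x {i ∈ A | i < m} 1 := by simp [esymGF]
        rw [h2]
        have h3 := pow_ne_zero j hq
        field_simp
        linear_combination signedQBinom q (k + 1) j * x m * h1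

end GeneratingFunctions

/-! ### From generating functions to cardinalities. -/

/-- The exponent of the monomial `q^s x^μ`, where `q` is the variable `none`. -/
noncomputable def blockExponent {k : ℕ} (s : ℕ) (μ : Fin k → Finset ℕ+) : Option ℕ+ →₀ ℕ :=
  Finsupp.single none s + ∑ j, ∑ v ∈ μ j, Finsupp.single (some v) 1

lemma blockExponent_none {k : ℕ} (s : ℕ) (μ : Fin k → Finset ℕ+) :
    blockExponent s μ none = s := by
  simp [blockExponent]

lemma blockExponent_some {k : ℕ} (s : ℕ) (μ : Fin k → Finset ℕ+) (v : ℕ+) :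
    blockExponent s μ (some v) = (∑ j, (μ j).val).count v := by
  classical
  simp only [blockExponent, Finsupp.add_apply, Finsupp.finsetSum_apply, Multiset.count_sum']
  rw [Finsupp.single_eq_of_ne (by simp), zero_add]
  refine Finset.sum_congr rfl fun j _ => ?_
  simp [Finsupp.single_apply, Multiset.count_eq_of_nodup (μ j).nodup]

lemma map_sum_monomial_blockExponent {F : Type*} [Field F] (φ : MvPolynomial (Option ℕ+) ℚ →+* F)
    {k : ℕ} (T : Finset (Fin k → Finset ℕ+)) (f : (Fin k → Finset ℕ+) → ℕ) :
    φ (∑ μ ∈ T, MvPolynomial.monomial (blockExponent (f μ) μ) 1) =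
      ∑ μ ∈ T, φ (MvPolynomial.X none) ^ f μ *
        blockMonomial (fun v => φ (MvPolynomial.X (some v))) μ := by
  have h : ∀ (s : ℕ) (μ : Fin k → Finset ℕ+),
      (MvPolynomial.monomial (blockExponent s μ) 1 : MvPolynomial (Option ℕ+) ℚ) =
        MvPolynomial.X none ^ s * ∏ j, ∏ v ∈ μ j, MvPolynomial.X (some v) := by
    intro s μ
    unfold blockExponent
    rw [← one_mul (1 : ℚ), ← MvPolynomial.monomial_mul, MvPolynomial.X_pow_eq_monomial,
      MvPolynomial.monomial_sum_one]
    simp only [MvPolynomial.monomial_sum_one]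
    rfl
  simp only [h, map_sum, map_mul, map_pow, map_prod, blockMonomial]

/-- The generating function identities divide by q and by q^(k+1) - q^j, so they are applied in the
fraction field of a polynomial ring over ℚ and pulled back by injectivity before comparing
coefficients. -/
theorem card_blockMajMIL_eq_card_blockMajBAST {k : ℕ} (A : Finset ℕ+) (d : Option ℕ+ →₀ ℕ) :
    {μ ∈ Fintype.piFinset (fun _ : Fin (k + 1) => nonemptySubsets A) |
        blockExponent (blockMajMIL μ) μ = d}.card =
      {μ ∈ Fintype.piFinset (fun _ : Fin (k + 1) => nonemptySubsets A) |
        blockExponent (blockMajBAST μ) μ = d}.card := by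
  classical
  set R := MvPolynomial (Option ℕ+) ℚ
  have hinj : Function.Injective (algebraMap R (FractionRing R)) :=
    IsFractionRing.injective R (FractionRing R)
  set q := algebraMap R (FractionRing R) (MvPolynomial.X none) with hqdef
  have hq : q ≠ 0 := by
    rw [hqdef, Ne, map_eq_zero_iff _ hinj]; exact MvPolynomial.X_ne_zero _
  have hq1 : ∀ n : ℕ, 0 < n → q ^ n ≠ 1 := by
    intro n hn h
    rw [hqdef, ← map_pow, map_eq_one_iff _ hinj] at h
    -- The constant coefficient of X^n is 0 for n > 0, so no positive power of the variable q is 1.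
    have := congrArg MvPolynomial.constantCoeff h
    simp [hn.ne'] at this
  have e := (sum_blockMajMIL hq hq1 (fun v : ℕ+ => algebraMap R (FractionRing R)
    (MvPolynomial.X (some v))) A k).trans (sum_blockMajBAST hq hq1 _ A k).symm
  rw [hqdef, ← map_sum_monomial_blockExponent, ← map_sum_monomial_blockExponent] at e
  have e' := congrArg (MvPolynomial.coeff d) (hinj e)
  simpa only [MvPolynomial.coeff_sum, MvPolynomial.coeff_monomial, Finset.sum_boole,
    Nat.cast_inj] using e'

theorem encard_blockMajMIL_eq_encard_blockMajBAST {k : ℕ} (β : ℕ+ →₀ ℕ) (m : ℕ) :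
    {μ ∈ OP β (k + 1) | blockMajMIL μ = m}.encard =
      {μ ∈ OP β (k + 1) | blockMajBAST μ = m}.encard := by
  classical
  have h : ∀ f : (Fin (k + 1) → Finset ℕ+) → ℕ, {μ ∈ OP β (k + 1) | f μ = m} =
      (({μ ∈ Fintype.piFinset (fun _ : Fin (k + 1) => nonemptySubsets β.support) |
        blockExponent (f μ) μ = β.optionElim m} :
        Finset (Fin (k + 1) → Finset ℕ+)) : Set (Fin (k + 1) → Finset ℕ+)) := by
    intro f
    ext μ
    have hd : blockExponent (f μ) μ =
        β.optionElim m ↔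
        f μ = m ∧ ∑ j, (μ j).val = Finsupp.toMultiset β := by
      rw [DFunLike.ext_iff, Multiset.ext]
      constructor
      · intro H
        refine ⟨by simpa [blockExponent_none] using H none, fun v => ?_⟩
        simpa [blockExponent_some] using H (some v)
      · rintro ⟨rfl, H⟩ (_ | v)
        · simp [blockExponent_none]
        · simpa [blockExponent_some] using H v
    simp only [Set.mem_ofPred_eq, OP, Finset.coe_filter, Fintype.mem_piFinset,
      mem_nonemptySubsets, hd]
    constructor
    · rintro ⟨⟨h1, h2⟩, h3⟩
      refine ⟨fun j => ⟨h1 j, fun v hv => ?_⟩, h3, h2⟩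
      rw [← Finsupp.mem_toMultiset, ← h2]
      exact Multiset.mem_sum.2 ⟨j, Finset.mem_univ j, hv⟩
    · rintro ⟨h1, h3, h2⟩
      exact ⟨⟨fun j => (h1 j).1, h2⟩, h3⟩
  rw [h, h, Set.encard_coe_eq_coe_finsetCard, Set.encard_coe_eq_coe_finsetCard,
    card_blockMajMIL_eq_card_blockMajBAST]

/-! ### Positions, letters and extremal occurrences in words. -/

section Words

lemma positions_eq_image (w : List ℕ) :
    positions w = (Finset.range w.length).image (· + 1) := by
  ext i
  simp only [positions, Finset.mem_Icc, Finset.mem_image, Finset.mem_range]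
  exact ⟨fun h => ⟨i - 1, by omega, by omega⟩, fun ⟨a, h, e⟩ => by omega⟩

lemma mem_positions {w : List ℕ} {i : ℕ} : i ∈ positions w ↔ 1 ≤ i ∧ i ≤ w.length := by
  simp [positions]

lemma letter_succ {w : List ℕ} {i : ℕ} (h : i < w.length) : letter w (i + 1) = w[i] := by
  simp [letter, h]

lemma sum_positions {M : Type*} [AddCommMonoid M] (w : List ℕ) (f : ℕ → M) :
    ∑ i ∈ positions w, f i = ∑ i : Fin w.length, f (i + 1) := by
  rw [positions_eq_image, Finset.sum_image fun _ _ _ _ h => Nat.succ_injective h,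
    Finset.sum_range]

lemma succ_iff {w : List ℕ} {a b : ℕ} :
    Succ w a b ↔ a ∈ w ∧ b ∈ w ∧ ∀ (i j : ℕ) (hi : i < w.length) (hj : j < w.length),
      w[i] = a → w[j] = b → j < i := by
  constructor
  · rintro ⟨i, hi, j, hj, rfl, rfl, hij⟩
    simp only [L, R, Finset.mem_filter] at hi hj
    have hi' := mem_positions.1 hi.1
    have hj' := mem_positions.1 hj.1
    obtain ⟨i, rfl⟩ : ∃ p, i = p + 1 := ⟨i - 1, by omega⟩
    obtain ⟨j, rfl⟩ : ∃ p, j = p + 1 := ⟨j - 1, by omega⟩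
    have li : i < w.length := by omega
    have lj : j < w.length := by omega
    refine ⟨letter_succ li ▸ List.getElem_mem _, letter_succ lj ▸ List.getElem_mem _, ?_⟩
    intro p q hp hq ep eq
    have h1 := hi.2 (p + 1) (mem_positions.2 (by omega)) (by rw [letter_succ hp, ep])
    have h2 := hj.2 (q + 1) (mem_positions.2 (by omega)) (by rw [letter_succ hq, eq])
    omega
  · rintro ⟨ha, hb, H⟩
    obtain ⟨p, hp, rfl⟩ := List.mem_iff_getElem.1 ha
    obtain ⟨q, hq, rfl⟩ := List.mem_iff_getElem.1 hb
    obtain ⟨i, hi, hi'⟩ := Finset.exists_min_image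
      {i ∈ positions w | letter w i = w[p]} id
      ⟨p + 1, Finset.mem_filter.2 ⟨mem_positions.2 (by omega), letter_succ hp⟩⟩
    obtain ⟨j, hj, hj'⟩ := Finset.exists_max_image
      {i ∈ positions w | letter w i = w[q]} id
      ⟨q + 1, Finset.mem_filter.2 ⟨mem_positions.2 (by omega), letter_succ hq⟩⟩
    rw [Finset.mem_filter] at hi hj
    have li := mem_positions.1 hi.1
    have lj := mem_positions.1 hj.1
    refine ⟨i, Finset.mem_filter.2 ⟨hi.1, fun l hl e => ?_⟩, j,
      Finset.mem_filter.2 ⟨hj.1, fun l hl e => ?_⟩, hi.2, hj.2, ?_⟩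
    · exact hi' l (Finset.mem_filter.2 ⟨hl, e.trans hi.2⟩)
    · exact hj' l (Finset.mem_filter.2 ⟨hl, e.trans hj.2⟩)
    · obtain ⟨i, rfl⟩ : ∃ p, i = p + 1 := ⟨i - 1, by omega⟩
      obtain ⟨j, rfl⟩ : ∃ p, j = p + 1 := ⟨j - 1, by omega⟩
      have := H i j (by omega) (by omega) (by rw [← letter_succ, hi.2]) (by rw [← letter_succ, hj.2])
      omega

lemma bk_eq {w : List ℕ} {k : ℕ} (hk : k ∈ w) (h : ∀ a ∈ w, a ≤ k) : bk w = k := by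
  apply le_antisymm
  · refine Finset.sup_le fun i hi => ?_
    have hi' := mem_positions.1 hi
    obtain ⟨i, rfl⟩ : ∃ p, i = p + 1 := ⟨i - 1, by omega⟩
    rw [letter_succ (by omega)]
    exact h _ (List.getElem_mem _)
  · obtain ⟨p, hp, rfl⟩ := List.mem_iff_getElem.1 hk
    rw [← letter_succ hp]
    exact Finset.le_sup (mem_positions.2 (by omega))

lemma pro_spec {w : List ℕ} (h : 1 ∈ w) :
    pro w ∈ positions w ∧ letter w (pro w) = 1 ∧
      ∀ i ∈ positions w, letter w i = 1 → i ≤ pro w := by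
  obtain ⟨p, hp, e⟩ := List.mem_iff_getElem.1 h
  have hne : {i ∈ positions w | letter w i = 1}.Nonempty :=
    ⟨p + 1, Finset.mem_filter.2 ⟨mem_positions.2 (by omega), by rw [letter_succ hp, e]⟩⟩
  obtain ⟨i, hi, he⟩ := Finset.exists_mem_eq_sup _ hne id
  have hi' := Finset.mem_filter.1 hi
  unfold pro
  rw [he]
  refine ⟨hi'.1, hi'.2, fun j hj e => ?_⟩
  rw [← he]
  exact Finset.le_sup (f := id) (Finset.mem_filter.2 ⟨hj, e⟩)

end Words

/-! ### The word of a partition as a sorted list of pairs. -/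

section Pairs

lemma blockIndices_eq_map {k : ℕ} (μ : Fin k → Finset ℕ+) (v : ℕ+) :
    blockIndices μ v = ((List.finRange k).filter fun j => v ∈ μ j).map fun j : Fin k => (j : ℕ) + 1 := by
  -- In `blockIndices` the whole list is coerced from `Fin k` to ℕ through the list monad, hence the
  -- `flatMap` of singletons.
  unfold blockIndices
  change List.map _ (List.flatMap (fun a : Fin k => [(a : ℕ)]) _) = _
  rw [← List.map_eq_flatMap, List.map_map]
  rfl

/-- The strict lexicographic order on pairs. -/
abbrev PairLT : ℕ+ × ℕ → ℕ+ × ℕ → Prop := Prod.Lex (· < ·) (· < ·)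

lemma pairLT_iff {p r : ℕ+ × ℕ} : PairLT p r ↔ p.1 < r.1 ∨ p.1 = r.1 ∧ p.2 < r.2 :=
  Prod.lex_def

/-- The lexicographically increasing list of the pairs `(v, j)` with `v` in the `j`-th block. -/
def pairList {k : ℕ} (μ : Fin k → Finset ℕ+) : List (ℕ+ × ℕ) :=
  ((Finset.univ.biUnion μ).sort (· ≤ ·)).flatMap fun v => (blockIndices μ v).map (Prod.mk v)

variable {k : ℕ} (μ : Fin k → Finset ℕ+)

lemma map_snd_pairList : (pairList μ).map Prod.snd = iota μ := by
  simp [pairList, iota, List.map_flatMap, Function.comp_def]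

variable {μ} in
lemma mem_pairList {v : ℕ+} {l : ℕ} :
    (v, l) ∈ pairList μ ↔ ∃ j : Fin k, v ∈ μ j ∧ l = j + 1 := by
  simp only [pairList, blockIndices_eq_map, List.mem_flatMap, Finset.mem_sort, Finset.mem_biUnion,
    Finset.mem_univ, true_and, List.map_map, List.mem_map, List.mem_filter, List.mem_finRange,
    decide_eq_true_eq, Function.comp, Prod.mk.injEq]
  constructor
  · rintro ⟨a, -, j, hj, rfl, rfl⟩
    exact ⟨j, hj, rfl⟩
  · rintro ⟨j, hj, rfl⟩
    exact ⟨v, ⟨j, hj⟩, j, hj, rfl, rfl⟩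

lemma pairwise_pairList : (pairList μ).Pairwise PairLT := by
  rw [pairList, List.pairwise_flatMap]
  constructor
  · intro v _
    rw [blockIndices_eq_map, List.map_map, List.pairwise_map]
    refine ((List.pairwise_lt_finRange k).filter _).imp fun {i j} h => ?_
    exact Prod.Lex.right _ (by simpa using h)
  · refine (Finset.sortedLT_sort _).pairwise.imp fun {a b} h x hx y hy => ?_
    obtain ⟨_, _, rfl⟩ := List.mem_map.1 hx
    obtain ⟨_, _, rfl⟩ := List.mem_map.1 hy
    exact Prod.Lex.left _ _ h

lemma sum_map_pairList {M : Type*} [AddCommMonoid M] (φ : ℕ+ × ℕ → M) :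
    ((pairList μ).map φ).sum = ∑ j, ∑ v ∈ μ j, φ (v, j + 1) := by
  have h1 : ∀ v, ((blockIndices μ v).map fun l => φ (v, l)).sum =
      ∑ j ∈ (Finset.univ : Finset (Fin k)) with v ∈ μ j, φ (v, j + 1) := by
    intro v
    rw [blockIndices_eq_map, List.map_map]
    rfl
  have h2 : ((pairList μ).map φ).sum = ∑ v ∈ Finset.univ.biUnion μ,
      ((blockIndices μ v).map fun l => φ (v, l)).sum := by
    rw [pairList, List.map_flatMap, List.flatMap, List.sum_flatten, List.map_map]
    conv_rhs => rw [← Finset.sort_toFinset (Finset.univ.biUnion μ) (· ≤ ·),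
      List.sum_toFinset _ (Finset.sort_nodup _ _)]
    simp [Function.comp_def]
  rw [h2]
  simp only [h1]
  refine Finset.sum_comm' fun v j => ?_
  simp only [Finset.mem_biUnion, Finset.mem_univ, true_and, Finset.mem_filter, and_true]
  exact ⟨fun h => h.2, fun h => ⟨⟨j, h⟩, h⟩⟩

variable {μ}

/-- Strict sortedness turns every comparison of positions in the word into a lexicographic
comparison of pairs; the translation of ≻ and of `pro` rests on this. -/
lemma pairLT_getElem_iff {i j : ℕ} (hi : i < (pairList μ).length) (hj : j < (pairList μ).length) :
    PairLT (pairList μ)[i] (pairList μ)[j] ↔ i < j := by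
  have H := List.pairwise_iff_getElem.1 (pairwise_pairList μ)
  refine ⟨fun h => ?_, H i j hi hj⟩
  by_contra hij
  rcases (not_lt.1 hij).eq_or_lt with rfl | hij
  · exact irrefl_of PairLT _ h
  · exact irrefl_of PairLT _ (trans_of PairLT h (H j i hj hi hij))

lemma mem_iota {l : ℕ} : l ∈ iota μ ↔ ∃ j : Fin k, (μ j).Nonempty ∧ l = j + 1 := by
  rw [← map_snd_pairList, List.mem_map]
  constructor
  · rintro ⟨⟨v, l⟩, h, rfl⟩
    obtain ⟨j, hj, rfl⟩ := mem_pairList.1 h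
    exact ⟨j, ⟨v, hj⟩, rfl⟩
  · rintro ⟨j, ⟨v, hv⟩, rfl⟩
    exact ⟨(v, j + 1), mem_pairList.2 ⟨j, hv, rfl⟩, rfl⟩

lemma getElem_pairList {i : ℕ} (hi : i < (pairList μ).length) :
    ∃ j : Fin k, (pairList μ)[i].1 ∈ μ j ∧ (pairList μ)[i].2 = j + 1 :=
  mem_pairList.1 (List.getElem_mem hi)

lemma length_pairList : (pairList μ).length = (iota μ).length := by
  rw [← map_snd_pairList, List.length_map]

lemma getElem_iota {i : ℕ} (hi : i < (iota μ).length) :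
    (iota μ)[i] = ((pairList μ)[i]'(by rwa [length_pairList])).2 := by
  simp only [← map_snd_pairList, List.getElem_map]

lemma sum_positions_iota {M : Type*} [AddCommMonoid M] (f : ℕ → M) (φ : ℕ+ × ℕ → M)
    (h : ∀ (i : ℕ) (hi : i < (pairList μ).length), f (i + 1) = φ (pairList μ)[i]) :
    ∑ i ∈ positions (iota μ), f i = ∑ j, ∑ v ∈ μ j, φ (v, j + 1) := by
  rw [← sum_map_pairList, sum_positions, ← Fin.sum_univ_fun_getElem]
  exact Fintype.sum_equiv (finCongr length_pairList.symm) _ _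
    fun i => h i (by rw [length_pairList]; exact i.2)

end Pairs

/-! ### The word statistics in terms of blocks. -/

section Statistics

variable {k : ℕ} {μ : Fin (k + 1) → Finset ℕ+}

lemma bk_iota (hμ : ∀ j, (μ j).Nonempty) : bk (iota μ) = k + 1 := by
  refine bk_eq (mem_iota.2 ⟨Fin.last k, hμ _, by simp⟩) fun a ha => ?_
  obtain ⟨j, -, rfl⟩ := mem_iota.1 ha
  omega

/-- Equal entries do not count: if v lies in both blocks, the smaller index comes first in the word,
so the comparison of v with u has to be strict. -/
lemma succ_iota_iff (hμ : ∀ j, (μ j).Nonempty) (i : Fin k) :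
    Succ (iota μ) (i + 1) (i + 1 + 1) ↔ BlockDescent (μ i.castSucc) (μ i.succ) := by
  rw [succ_iff]
  constructor
  · rintro ⟨-, -, H⟩ u hu v hv
    obtain ⟨p, hp, ep⟩ := List.mem_iff_getElem.1
      (mem_pairList.2 ⟨i.castSucc, hu, rfl⟩ : (u, _) ∈ pairList μ)
    obtain ⟨r, hr, er⟩ := List.mem_iff_getElem.1
      (mem_pairList.2 ⟨i.succ, hv, rfl⟩ : (v, _) ∈ pairList μ)
    have h := H p r (by rwa [← length_pairList]) (by rwa [← length_pairList])
      (by rw [getElem_iota, ep]; simp) (by rw [getElem_iota, er]; simp)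
    rw [← pairLT_getElem_iff hr hp, ep, er, pairLT_iff] at h
    rcases h with h | ⟨-, h⟩
    · exact h
    · simp at h
  · intro H
    refine ⟨mem_iota.2 ⟨i.castSucc, hμ _, by simp⟩, mem_iota.2 ⟨i.succ, hμ _, by simp⟩, ?_⟩
    intro p r hp hr ep er
    rw [getElem_iota] at ep er
    rw [← length_pairList] at hp hr
    rw [← pairLT_getElem_iff hr hp]
    obtain ⟨j, hj, ej⟩ := getElem_pairList hp
    obtain ⟨l, hl, el⟩ := getElem_pairList hr
    obtain rfl : j = i.castSucc := Fin.ext (by rw [Fin.val_castSucc]; omega)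
    obtain rfl : l = i.succ := Fin.ext (by rw [Fin.val_succ]; omega)
    exact pairLT_iff.2 (Or.inl (H _ hj _ hl))

lemma not_succ_iota_last : ¬ Succ (iota μ) (k + 1) (k + 1 + 1) := by
  rw [succ_iff]
  rintro ⟨-, h, -⟩
  obtain ⟨j, -, e⟩ := mem_iota.1 h
  omega

lemma sum_succ_iota (hμ : ∀ j, (μ j).Nonempty) (f : ℕ → ℤ) :
    (∑ i ∈ Finset.Icc 1 (bk (iota μ)), if Succ (iota μ) i (i + 1) then f i else 0) =
      ∑ i : Fin k, if BlockDescent (μ i.castSucc) (μ i.succ) then f (i + 1) else 0 := by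
  -- The top summand i = k + 1 vanishes because k + 2 is not a letter.
  rw [bk_iota hμ, Finset.sum_Icc_succ_top (by omega), if_neg not_succ_iota_last, add_zero]
  have : Finset.Icc 1 k = (Finset.range k).image (· + 1) := by
    ext i
    simp only [Finset.mem_Icc, Finset.mem_image, Finset.mem_range]
    exact ⟨fun h => ⟨i - 1, by omega, by omega⟩, fun ⟨a, h, e⟩ => by omega⟩
  rw [this, Finset.sum_image fun _ _ _ _ h => Nat.succ_injective h, Finset.sum_range]
  simp only [succ_iota_iff hμ]

lemma bmajMIL_iota (hμ : ∀ j, (μ j).Nonempty) : bmajMIL (iota μ) = blockMajMIL μ := by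
  have h : MIL (iota μ) = ∑ j, ∑ v ∈ μ j, (((j : ℕ) + 1 : ℕ) - 1 : ℤ) :=
    sum_positions_iota _ (fun z => (z.2 : ℤ) - 1) fun i hi => by
      rw [letter_succ (by rwa [← length_pairList]), getElem_iota]
  rw [bmajMIL, bMAJ, sum_succ_iota hμ (fun i => (i : ℤ)), h, blockMajMIL, add_comm]
  push_cast
  simp [mul_comm]

/-- Here i counts from 0 while `pro` counts from 1, so `pro ≤ i` means strictly after the last
letter 1. -/
lemma pro_iota_le_iff (hμ : ∀ j, (μ j).Nonempty) {i : ℕ} (hi : i < (pairList μ).length) :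
    pro (iota μ) ≤ i ↔ ∀ u ∈ μ 0, PairLT (u, 1) (pairList μ)[i] := by
  obtain ⟨h1, h2, h3⟩ := pro_spec (mem_iota.2 ⟨0, hμ 0, by simp⟩ : 1 ∈ iota μ)
  have h1' := mem_positions.1 h1
  obtain ⟨p, hp⟩ : ∃ p, pro (iota μ) = p + 1 := ⟨pro (iota μ) - 1, by omega⟩
  rw [hp] at h1' h2 h3 ⊢
  have hpl : p < (pairList μ).length := by rw [length_pairList]; omega
  rw [letter_succ (by omega), getElem_iota] at h2
  constructor
  · intro hpi u hu
    obtain ⟨r, hr, er⟩ := List.mem_iff_getElem.1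
      (mem_pairList.2 ⟨0, hu, by simp⟩ : (u, 1) ∈ pairList μ)
    have hr' : r < (iota μ).length := by rwa [← length_pairList]
    have := h3 (r + 1) (mem_positions.2 (by omega)) (by rw [letter_succ hr', getElem_iota, er])
    rw [← er, pairLT_getElem_iff]
    omega
  · intro H
    obtain ⟨j, hj, ej⟩ := getElem_pairList hpl
    obtain rfl : j = 0 := Fin.ext (by rw [Fin.val_zero]; omega)
    have := H _ hj
    rw [← show (pairList μ)[p] = (_, 1) from Prod.ext rfl h2, pairLT_getElem_iff] at this
    omega

/-- The term n - `pro` counts the letters after the last 1, that is, the pairs (v, j) outside the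
first block with v ≥ max B_1; each lowers its contribution by 1. The term `bndes` is k minus the
number of block descents, which lowers the weight of each descent by 1 and leaves the constant k. -/
lemma bmajBAST_iota (hμ : ∀ j, (μ j).Nonempty) : bmajBAST (iota μ) = blockMajBAST μ := by
  have hpro : ((iota μ).length : ℤ) - pro (iota μ) =
      ∑ i ∈ positions (iota μ), if pro (iota μ) < i then (1 : ℤ) else 0 := by
    obtain ⟨h1, -, -⟩ := pro_spec (mem_iota.2 ⟨0, hμ 0, by simp⟩ : 1 ∈ iota μ)
    have h1' := mem_positions.1 h1
    rw [← Finset.sum_filter, Finset.sum_const, Nat.smul_one_eq_cast]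
    have : {i ∈ positions (iota μ) | pro (iota μ) < i} =
        Finset.Ioc (pro (iota μ)) (iota μ).length := by
      ext i; simp only [Finset.mem_filter, mem_positions, Finset.mem_Ioc]; omega
    rw [this, Nat.card_Ioc, Nat.cast_sub h1'.2]
  have h : MIL (iota μ) - ((iota μ).length - pro (iota μ)) =
      ∑ j, ∑ v ∈ μ j, ((((j : ℕ) + 1 : ℕ) - 1 : ℤ) -
        if ∀ u ∈ μ 0, PairLT (u, 1) (v, (j : ℕ) + 1) then 1 else 0) := by
    rw [hpro, MIL, ← Finset.sum_sub_distrib]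
    refine sum_positions_iota _ (fun z => ((z.2 : ℤ) - 1) -
      if ∀ u ∈ μ 0, PairLT (u, 1) z then 1 else 0) fun i hi => ?_
    rw [letter_succ (by rwa [← length_pairList]), getElem_iota]
    simp only [← pro_iota_le_iff hμ hi, Nat.lt_succ_iff]
  have h' : MIL (iota μ) - ((iota μ).length - pro (iota μ)) =
      ∑ j : Fin k, ∑ v ∈ μ j.succ, if ∃ u ∈ μ 0, v < u then ((j : ℕ) : ℤ) + 1 else (j : ℕ) := by
    rw [h, Fin.sum_univ_succ, Finset.sum_eq_zero, zero_add]
    · refine Finset.sum_congr rfl fun j _ => Finset.sum_congr rfl fun v _ => ?_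
      -- Outside the first block the index exceeds 1, so u = v is allowed and the lexicographic
      -- condition becomes u ≤ v.
      have : (∀ u ∈ μ 0, PairLT (u, 1) (v, (j.succ : ℕ) + 1)) ↔ ¬ ∃ u ∈ μ 0, v < u := by
        simp only [pairLT_iff, not_exists, not_and, not_lt]
        refine forall₂_congr fun u _ => ⟨fun h => ?_, fun h => ?_⟩
        · exact h.elim le_of_lt fun h => h.1.le
        · exact h.lt_or_eq.imp_right fun h => ⟨h, by simp⟩
      simp only [this]
      split_ifs <;> simp_all
    · intro v hv
      rw [if_neg]
      · simp
      · intro H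
        exact irrefl_of PairLT _ (H v hv)
  have hM := sum_succ_iota hμ (fun i => (i : ℤ))
  have hN := sum_succ_iota hμ (fun _ => 1)
  have hMN : (∑ i : Fin k, if BlockDescent (μ i.castSucc) (μ i.succ) then ((i : ℕ) : ℤ) else 0) =
      bMAJ (iota μ) - ∑ i ∈ Finset.Icc 1 (bk (iota μ)),
        if Succ (iota μ) i (i + 1) then (1 : ℤ) else 0 := by
    rw [bMAJ, hM, hN, ← Finset.sum_sub_distrib]
    refine Finset.sum_congr rfl fun i _ => ?_
    split_ifs <;> simp
  rw [bmajBAST, bmajMIL, bndes, blockMajBAST]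
  push_cast
  rw [hMN, ← h', bk_iota hμ]
  push_cast
  ring

end Statistics

/-! ### Partitions of a given weight as words with prescribed ascents. -/

section Encoding

/-- The words of length `n` whose set of letters is `{1, …, k}`. -/
def surjWords (k n : ℕ) : Set (List ℕ) := {w | w.length = n ∧ ∀ l, l ∈ w ↔ 1 ≤ l ∧ l ≤ k}

lemma surjWords_finite (k n : ℕ) : (surjWords k n).Finite := by
  refine ((List.finite_length_eq (Fin (k + 1)) n).image (List.map Fin.val)).subset ?_
  rintro w ⟨rfl, h⟩
  have hw : ∀ l ∈ w, l < k + 1 := fun l hl => by have := (h l).1 hl; omega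
  exact ⟨w.pmap (fun l hl => ⟨l, hl⟩) hw, by simp, by simp [List.map_pmap]⟩

lemma succ_mem_Asc {w : List ℕ} {p : ℕ} :
    p + 1 ∈ Asc w ↔ ∃ h : p + 1 < w.length, w[p] < w[p + 1] := by
  simp only [Asc, Finset.mem_filter, mem_positions]
  constructor
  · rintro ⟨-, h, h'⟩
    have hp : p + 1 < w.length := by omega
    rw [letter_succ hp, letter_succ (by omega)] at h'
    exact ⟨hp, h'⟩
  · rintro ⟨h, h'⟩
    rw [letter_succ h, letter_succ (by omega)]
    exact ⟨by omega, by omega, h'⟩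

lemma Asc_subset (w : List ℕ) : Asc w ⊆ Finset.Icc 1 (w.length - 1) := by
  intro i hi
  simp only [Asc, Finset.mem_filter, mem_positions, Finset.mem_Icc] at hi ⊢
  omega

/-- The positions `i` such that the `i`-th and the `(i + 1)`-st entry of `cs` agree. -/
def tieSet (cs : List ℕ+) : Finset ℕ :=
  {i ∈ Finset.Icc 1 (cs.length - 1) | cs.getD (i - 1) 1 = cs.getD i 1}

lemma tieSet_subset (cs : List ℕ+) : tieSet cs ⊆ Finset.Icc 1 (cs.length - 1) :=
  Finset.filter_subset _ _

lemma succ_mem_tieSet {cs : List ℕ+} {p : ℕ} :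
    p + 1 ∈ tieSet cs ↔ ∃ h : p + 1 < cs.length, cs[p] = cs[p + 1] := by
  simp only [tieSet, Finset.mem_filter, Finset.mem_Icc, Nat.add_sub_cancel]
  constructor
  · rintro ⟨h, h'⟩
    have hp : p + 1 < cs.length := by omega
    rw [List.getD_eq_getElem _ _ hp, List.getD_eq_getElem _ _ (by omega)] at h'
    exact ⟨hp, h'⟩
  · rintro ⟨h, h'⟩
    rw [List.getD_eq_getElem _ _ h, List.getD_eq_getElem _ _ (by omega)]
    exact ⟨by omega, h'⟩

lemma tieSet_subset_Asc_iff {cs : List ℕ+} {w : List ℕ} :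
    tieSet cs ⊆ Asc w ↔ ∀ p, p + 1 ∈ tieSet cs → p + 1 ∈ Asc w := by
  refine ⟨fun h p hp => h hp, fun h i hi => ?_⟩
  have := Finset.mem_Icc.1 (tieSet_subset cs hi)
  obtain ⟨p, rfl⟩ : ∃ p, i = p + 1 := ⟨i - 1, by omega⟩
  exact h p hi

variable {k : ℕ}

lemma pairwise_zip {cs : List ℕ+} {w : List ℕ} (hc : cs.Pairwise (· ≤ ·))
    (hw : w.length = cs.length) (h : tieSet cs ⊆ Asc w) : (cs.zip w).Pairwise PairLT := by
  rw [← List.isChain_iff_pairwise, List.isChain_iff_getElem]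
  intro p hp
  have hpc : p + 1 < cs.length := by rw [List.length_zip] at hp; omega
  rw [List.getElem_zip, List.getElem_zip, pairLT_iff]
  rcases (List.pairwise_iff_getElem.1 hc p (p + 1) (by omega) hpc (by omega)).lt_or_eq with e | e
  · exact Or.inl e
  · obtain ⟨_, h'⟩ := succ_mem_Asc.1 (h (succ_mem_tieSet.2 ⟨hpc, e⟩))
    exact Or.inr ⟨e, h'⟩

lemma coe_map_fst_pairList (μ : Fin k → Finset ℕ+) :
    (((pairList μ).map Prod.fst : List ℕ+) : Multiset ℕ+) = ∑ j, (μ j).val := by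
  have h := sum_map_pairList μ (fun z => ({z.1} : Multiset ℕ+))
  simp only [Finset.sum_multiset_singleton] at h
  rw [← h, ← Multiset.sum_map_singleton ((pairList μ).map Prod.fst : Multiset ℕ+)]
  simp [Function.comp_def]

lemma map_fst_pairList {β : ℕ+ →₀ ℕ} {cs : List ℕ+} (hc : cs.Pairwise (· ≤ ·))
    (hcβ : (cs : Multiset ℕ+) = Finsupp.toMultiset β) {μ : Fin k → Finset ℕ+} (hμ : μ ∈ OP β k) :
    (pairList μ).map Prod.fst = cs := by
  refine List.Perm.eq_of_pairwise' (r := (· ≤ ·)) ?_ hc ?_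
  · rw [List.pairwise_map]
    exact (pairwise_pairList μ).imp fun h => (pairLT_iff.1 h).elim le_of_lt fun h => h.1.le
  · rw [← Multiset.coe_eq_coe, coe_map_fst_pairList, hcβ, hμ.2]

lemma pairList_eq_zip {β : ℕ+ →₀ ℕ} {cs : List ℕ+} (hc : cs.Pairwise (· ≤ ·))
    (hcβ : (cs : Multiset ℕ+) = Finsupp.toMultiset β) {μ : Fin k → Finset ℕ+} (hμ : μ ∈ OP β k) :
    pairList μ = cs.zip (iota μ) :=
  List.zip_of_prod (map_fst_pairList hc hcβ hμ) (map_snd_pairList μ)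

/-- Zipping a word with `cs` recovers the pair list, hence the blocks. At a tie of `cs` two
neighbouring pairs share their first entry, so being lexicographically increasing means precisely an
ascent of the word there; elsewhere the order is automatic. -/
theorem bijOn_iota {β : ℕ+ →₀ ℕ} {cs : List ℕ+} (hc : cs.Pairwise (· ≤ ·))
    (hcβ : (cs : Multiset ℕ+) = Finsupp.toMultiset β) :
    Set.BijOn iota (OP β k) {w ∈ surjWords k cs.length | tieSet cs ⊆ Asc w} := by
  refine ⟨fun μ hμ => ⟨⟨?_, fun l => ?_⟩, ?_⟩, fun μ hμ ν hν h => ?_, fun w hw => ?_⟩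
  · rw [← length_pairList, ← map_fst_pairList hc hcβ hμ, List.length_map]
  · rw [mem_iota]
    constructor
    · rintro ⟨j, -, rfl⟩
      omega
    · rintro ⟨h1, h2⟩
      exact ⟨⟨l - 1, by omega⟩, hμ.1 _, by simp; omega⟩
  · rw [tieSet_subset_Asc_iff]
    intro p hp
    obtain ⟨h, e⟩ := succ_mem_tieSet.1 hp
    have hfst := map_fst_pairList hc hcβ hμ
    have hl : p + 1 < (pairList μ).length := by
      rw [← hfst, List.length_map] at h; exact h
    refine succ_mem_Asc.2 ⟨by rwa [← length_pairList], ?_⟩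
    rw [getElem_iota, getElem_iota]
    have h1 := (pairLT_getElem_iff (by omega) hl).2 (Nat.lt_succ_self p)
    simp only [← hfst, List.getElem_map] at e
    exact ((pairLT_iff.1 h1).resolve_left e.not_lt).2
  · have hz : pairList μ = pairList ν := by
      rw [pairList_eq_zip hc hcβ hμ, pairList_eq_zip hc hcβ hν, h]
    have key : ∀ (μ : Fin k → Finset ℕ+) j v, v ∈ μ j ↔ (v, (j : ℕ) + 1) ∈ pairList μ := by
      intro μ j v
      rw [mem_pairList]
      exact ⟨fun h => ⟨j, h, rfl⟩, fun ⟨i, hi, e⟩ => by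
        obtain rfl : j = i := Fin.ext (by omega)
        exact hi⟩
    funext j
    ext v
    rw [key, key, hz]
  · obtain ⟨⟨hlen, hlet⟩, htie⟩ := hw
    have hsort := pairwise_zip hc hlen htie
    have hsnd : (cs.zip w).map Prod.snd = w := List.map_snd_zip hlen.le
    have hfst : (cs.zip w).map Prod.fst = cs := List.map_fst_zip hlen.ge
    set μ : Fin k → Finset ℕ+ := fun j =>
      (((cs.zip w).filter fun z => z.2 = (j : ℕ) + 1).map Prod.fst).toFinset with hμdef
    have hmem : ∀ j v, v ∈ μ j ↔ (v, (j : ℕ) + 1) ∈ cs.zip w := by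
      intro j v
      simp [hμdef]
    have hz : pairList μ = cs.zip w := by
      have hnd : ∀ l : List (ℕ+ × ℕ), l.Pairwise PairLT → l.Nodup := fun l hl =>
        hl.imp fun h => by rintro rfl; exact irrefl_of PairLT _ h
      refine List.Perm.eq_of_pairwise (le := PairLT)
        (fun a b _ _ h1 h2 => (irrefl_of PairLT a (trans_of PairLT h1 h2)).elim)
        (pairwise_pairList μ) hsort ?_
      rw [List.perm_ext_iff_of_nodup (hnd _ (pairwise_pairList μ)) (hnd _ hsort)]
      rintro ⟨v, l⟩
      rw [mem_pairList]
      constructor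
      · rintro ⟨j, hj, rfl⟩
        exact (hmem j v).1 hj
      · intro h
        have hl := (hlet l).1 (hsnd ▸ List.mem_map_of_mem (f := Prod.snd) h)
        obtain ⟨l, rfl⟩ : ∃ p, l = p + 1 := ⟨l - 1, by omega⟩
        exact ⟨⟨l, by omega⟩, (hmem _ v).2 h, rfl⟩
    refine ⟨μ, ⟨fun j => ?_, ?_⟩, ?_⟩
    · have : (j : ℕ) + 1 ∈ w := (hlet _).2 (by omega)
      rw [← hsnd] at this
      obtain ⟨⟨v, l⟩, h, e⟩ := List.mem_map.1 this
      exact ⟨v, (hmem j v).2 (e ▸ h)⟩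
    · rw [← coe_map_fst_pairList, hz, hfst, hcβ]
    · rw [← map_snd_pairList, hz, hsnd]

lemma encard_OP_eq {β : ℕ+ →₀ ℕ} {cs : List ℕ+} (hc : cs.Pairwise (· ≤ ·))
    (hcβ : (cs : Multiset ℕ+) = Finsupp.toMultiset β) (p : List ℕ → Prop) :
    {μ ∈ OP β k | p (iota μ)}.encard =
      {w ∈ surjWords k cs.length | tieSet cs ⊆ Asc w ∧ p w}.encard := by
  have h := bijOn_iota (k := k) hc hcβ
  have e : {w ∈ surjWords k cs.length | tieSet cs ⊆ Asc w ∧ p w} =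
      iota '' {μ ∈ OP β k | p (iota μ)} := by
    ext w
    constructor
    · rintro ⟨h1, h2, h3⟩
      obtain ⟨μ, hμ, rfl⟩ := h.surjOn ⟨h1, h2⟩
      exact ⟨μ, ⟨hμ, h3⟩, rfl⟩
    · rintro ⟨μ, ⟨hμ, h3⟩, rfl⟩
      exact ⟨(h.mapsTo hμ).1, (h.mapsTo hμ).2, h3⟩
  rw [e, Set.InjOn.encard_image (h.injOn.mono fun _ h => h.1)]

end Encoding

/-! ### Inclusion–exclusion over ascent sets. -/

lemma encard_bmajMIL_eq_encard_bmajBAST {k : ℕ} (β : ℕ+ →₀ ℕ) (m : ℤ) :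
    {μ ∈ OP β (k + 1) | bmajMIL (iota μ) = m}.encard =
      {μ ∈ OP β (k + 1) | bmajBAST (iota μ) = m}.encard := by
  have h1 : {μ ∈ OP β (k + 1) | bmajMIL (iota μ) = m} =
      {μ ∈ OP β (k + 1) | (blockMajMIL μ : ℤ) = m} := by
    ext μ; exact and_congr_right fun hμ => by rw [bmajMIL_iota hμ.1]
  have h2 : {μ ∈ OP β (k + 1) | bmajBAST (iota μ) = m} =
      {μ ∈ OP β (k + 1) | (blockMajBAST μ : ℤ) = m} := by
    ext μ; exact and_congr_right fun hμ => by rw [bmajBAST_iota hμ.1]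
  rw [h1, h2]
  -- Both block statistics are natural numbers, so negative m gives two empty sets.
  rcases lt_or_ge m 0 with hm | hm
  · congr 1
    ext μ
    exact and_congr_right fun _ => by omega
  · lift m to ℕ using hm
    simpa only [Nat.cast_inj] using encard_blockMajMIL_eq_encard_blockMajBAST β m

lemma exists_tieSet_eq (n : ℕ) (D : Finset ℕ) (hD : D ⊆ Finset.Icc 1 (n - 1)) :
    ∃ cs : List ℕ+, cs.length = n ∧ cs.Pairwise (· ≤ ·) ∧ tieSet cs = D := by
  -- f increases by 1 at each position outside D and stays constant at those in D.
  set f : ℕ → ℕ := fun p => ∑ j ∈ Finset.range p, if j + 1 ∈ D then 0 else 1 with hf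
  have hmono : Monotone f := monotone_nat_of_le_succ fun p => by
    simp [hf, Finset.sum_range_succ]
  refine ⟨List.ofFn fun i : Fin n => (f i).succPNat, List.length_ofFn, ?_, ?_⟩
  · rw [List.pairwise_ofFn]
    exact fun i j hij => Nat.succPNat_le_succPNat.2 (hmono hij.le)
  · have key : ∀ p, p + 1 ∈ tieSet (List.ofFn fun i : Fin n => (f i).succPNat) ↔
        p + 1 ∈ D := by
      intro p
      rw [succ_mem_tieSet]
      simp only [List.length_ofFn, List.getElem_ofFn, Nat.succPNat_inj]
      have hfp : f (p + 1) = f p + if p + 1 ∈ D then 0 else 1 := Finset.sum_range_succ _ _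
      rw [hfp]
      constructor
      · rintro ⟨-, h⟩
        by_contra h'
        rw [if_neg h'] at h
        omega
      · intro h
        have := Finset.mem_Icc.1 (hD h)
        exact ⟨by omega, by simp [h]⟩
    ext i
    rcases i with _ | i
    · exact iff_of_false (fun h => by simpa using tieSet_subset _ h) (fun h => by simpa using hD h)
    · exact key i

/-- Inclusion–exclusion as a downward induction on S: the count over supersets of S is the count at
S plus the counts at strictly larger sets, which agree by induction. -/
lemma card_filter_eq_of_superset {ι : Type*} (W : Finset ι) (a : ι → Finset ℕ) (U : Finset ℕ)
    (ha : ∀ w ∈ W, a w ⊆ U) (p r : ι → Prop) [DecidablePred p] [DecidablePred r]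
    (h : ∀ D ⊆ U, {w ∈ W | D ⊆ a w ∧ p w}.card = {w ∈ W | D ⊆ a w ∧ r w}.card) (S : Finset ℕ) :
    {w ∈ W | a w = S ∧ p w}.card = {w ∈ W | a w = S ∧ r w}.card := by
  by_cases hS : S ⊆ U
  swap
  · rw [Finset.filter_false_of_mem, Finset.filter_false_of_mem]
    · rintro w hw ⟨rfl, -⟩; exact hS (ha w hw)
    · rintro w hw ⟨rfl, -⟩; exact hS (ha w hw)
  have key : ∀ (p : ι → Prop) [DecidablePred p] (S : Finset ℕ), S ⊆ U →
      {w ∈ W | S ⊆ a w ∧ p w}.card = {w ∈ W | a w = S ∧ p w}.card +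
        ∑ T ∈ {T ∈ U.powerset | S ⊂ T}, {w ∈ W | a w = T ∧ p w}.card := by
    intro p _ S hS
    have hmaps : Set.MapsTo a ({w ∈ W | S ⊆ a w ∧ p w} : Finset ι)
        ({T ∈ U.powerset | S ⊆ T} : Finset (Finset ℕ)) := by
      intro w hw
      simp only [Finset.coe_filter, Set.mem_ofPred_eq, Finset.mem_powerset] at hw ⊢
      exact ⟨ha w hw.1, hw.2.1⟩
    have hins : {T ∈ U.powerset | S ⊆ T} = insert S {T ∈ U.powerset | S ⊂ T} := by
      ext T
      simp only [Finset.mem_filter, Finset.mem_powerset, Finset.mem_insert,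
        Finset.ssubset_iff_subset_ne]
      constructor
      · rintro ⟨h1, h2⟩
        by_cases e : T = S
        · exact Or.inl e
        · exact Or.inr ⟨h1, h2, Ne.symm e⟩
      · rintro (rfl | h)
        · exact ⟨hS, subset_rfl⟩
        · exact ⟨h.1, h.2.1⟩
    have hfib : ∀ T, S ⊆ T → {w ∈ {w ∈ W | S ⊆ a w ∧ p w} | a w = T} =
        {w ∈ W | a w = T ∧ p w} := by
      intro T hT
      rw [Finset.filter_filter]
      refine Finset.filter_congr fun w _ => ⟨fun h => ⟨h.2, h.1.2⟩, ?_⟩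
      rintro ⟨rfl, hp⟩
      exact ⟨⟨hT, hp⟩, rfl⟩
    rw [Finset.card_eq_sum_card_fiberwise hmaps, hins, Finset.sum_insert (by simp),
      hfib S subset_rfl]
    congr 1
    exact Finset.sum_congr rfl fun T hT => by rw [hfib T (Finset.mem_filter.1 hT).2.subset]
  induction hN : (U \ S).card using Nat.strong_induction_on generalizing S with
  | _ N ih =>
    have e := h S hS
    rw [key p S hS, key r S hS, Finset.sum_congr rfl fun T hT => ?_] at e
    · exact Nat.add_right_cancel e
    · obtain ⟨hT, hST⟩ := Finset.mem_filter.1 hT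
      rw [Finset.mem_powerset] at hT
      refine ih _ ?_ T hT rfl
      rw [← hN]
      refine Finset.card_lt_card ⟨Finset.sdiff_subset_sdiff subset_rfl hST.subset, fun H => ?_⟩
      obtain ⟨x, hx, hxS⟩ := Finset.exists_of_ssubset hST
      exact (Finset.mem_sdiff.1 (H (Finset.mem_sdiff.2 ⟨hT hx, hxS⟩))).2 hx

/-- For each D, the words with D ⊆ Asc(w) are the encodings of all partitions of one weight, namely
the content of a list with tie set D, so the equidistribution on that `OP` supplies the counts for
inclusion–exclusion. -/
theorem encard_surjWords_Asc_eq (k n : ℕ) (S : Finset ℕ) (m : ℤ) :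
    {w ∈ surjWords (k + 1) n | Asc w = S ∧ bmajMIL w = m}.encard =
      {w ∈ surjWords (k + 1) n | Asc w = S ∧ bmajBAST w = m}.encard := by
  classical
  have hcoe : ∀ (p : List ℕ → Prop) [DecidablePred p], {w ∈ surjWords (k + 1) n | p w}.encard =
      ({w ∈ (surjWords_finite (k + 1) n).toFinset | p w}.card : ℕ∞) := fun p _ => by
    rw [← Set.encard_coe_eq_coe_finsetCard]
    simp
  rw [hcoe, hcoe, Nat.cast_inj]
  refine card_filter_eq_of_superset _ Asc (Finset.Icc 1 (n - 1)) (fun w hw => ?_)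
    (fun w => bmajMIL w = m) (fun w => bmajBAST w = m) (fun D hD => ?_) S
  · have hw' := (Set.Finite.mem_toFinset _).1 hw
    rw [← hw'.1]
    exact Asc_subset w
  · obtain ⟨cs, rfl, hc, rfl⟩ := exists_tieSet_eq n D hD
    have hcβ : (cs : Multiset ℕ+) = Finsupp.toMultiset (Multiset.toFinsupp (cs : Multiset ℕ+)) := by
      simp
    rw [← Nat.cast_inj (R := ℕ∞), ← hcoe, ← hcoe, ← encard_OP_eq hc hcβ (bmajMIL · = m),
      ← encard_OP_eq hc hcβ (bmajBAST · = m)]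
    exact encard_bmajMIL_eq_encard_bmajBAST _ m

end OMP

theorem mainTheorem11 (n k : ℕ) (hk : 1 ≤ k) (hkn : k ≤ n) (β : ℕ+ →₀ ℕ)
    (hβ : OMP.IsWeakComposition β n) :
    OMP.SameDistribution (OMP.OP β k)
      (fun μ => (OMP.Asc (OMP.iota μ), OMP.bmajMIL (OMP.iota μ)))
      (fun μ => (OMP.Asc (OMP.iota μ), OMP.bmajBAST (OMP.iota μ))) := by
  rintro ⟨S, m⟩
  obtain ⟨k, rfl⟩ : ∃ l, k = l + 1 := ⟨k - 1, by omega⟩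
  set cs := (Finsupp.toMultiset β).sort (· ≤ ·) with hcdef
  have hc : cs.Pairwise (· ≤ ·) := Multiset.pairwise_sort _ _
  have hcβ : (cs : Multiset ℕ+) = Finsupp.toMultiset β := Multiset.sort_eq _ _
  rw [OMP.encard_OP_eq hc hcβ (fun w => (OMP.Asc w, OMP.bmajMIL w) = (S, m)),
    OMP.encard_OP_eq hc hcβ (fun w => (OMP.Asc w, OMP.bmajBAST w) = (S, m))]
  simp only [Prod.mk.injEq]
  -- If S contains the ties of `cs`, the tie condition is implied by Asc(w) = S and β drops out;
  -- otherwise both sides are empty.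
  by_cases hS : OMP.tieSet cs ⊆ S
  · have e : ∀ (w : List ℕ) (p : Prop), OMP.tieSet cs ⊆ OMP.Asc w ∧ OMP.Asc w = S ∧ p ↔
        OMP.Asc w = S ∧ p := fun w p => ⟨fun h => h.2, fun h => ⟨h.1 ▸ hS, h⟩⟩
    simp only [e]
    exact OMP.encard_surjWords_Asc_eq k cs.length S m
  · have e : ∀ (w : List ℕ) (p : Prop), OMP.tieSet cs ⊆ OMP.Asc w ∧ OMP.Asc w = S ∧ p ↔
        False := fun w p => iff_of_false (fun h => hS (h.2.1 ▸ h.1)) id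
    simp only [e]
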